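/- Let $A$ be a C*-algebra. A closed two-sided ideal $J$ of $A$ is regarded as a Hilbert C*-module over $A$, a submodule of the Hilbert $A$-module $A$. The *compact endomorphisms* of a Hilbert $A$-module $Y$ are the elements of the operator-norm closed linear span of the rank one maps $\theta_{x,y}$, $x,y\in Y$, where $\theta_{x,y}(z)$ is $x$ multiplied by the scalar $\langle y,z\rangle\in A$. For closed two-sided ideals $I,J$ of $A$ write $I\subset\subset J$ if $I\subseteq J$ and there is a compact self-adjoint endomorphism $b$ of the Hilbert $A$-module $J$ such that $b(x)=x$ for all $x\in I$. Let $A\otimes A$ be the spatial (minimal) tensor product, that is, the norm closure of the algebraic tensor product $A\odot A$ in the bounded operators on $H\otimes K$, where $A$ is represented faithfully on Hilbert spaces $H$ and $K$. More generally, $A\otimes A$ may be the completion of $A\odot A$ in any C*-norm, for example the maximal one. For closed two-sided ideals $I,J$ of $A$, let $I\otimes J$ be the closure in $A\otimes A$ of the linear span of all $x\otimes y$ with $x\in I$, $y\in J$. It is a closed two-sided ideal of $A\otimes A$, and as a Hilbert $A\otimes A$-module it is the external tensor product of the Hilbert modules $I$ and $J$. **Corollary 4.2.** Let $I_1,I_2,J_1,J_2$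 be closed two-sided ideals of $A$ with $I_1\subset\subset J_1$ and $I_2\subset\subset J_2$. Then $$I_1\otimes I_2\subset\subset J_1\otimes J_2 .$$ Moreover, if $I_1$ and $I_2$ are countably generated as Hilbert C*-modules, then so is $I_1\otimes I_2$, and likewise for $J_1$, $J_2$ and $J_1\otimes J_2$. -/

import Mathlib

open scoped TensorProduct

noncomputable section

namespace HilbertIdeal

/-! ### Hilbert C*-modules: compact endomorphisms, compact containment -/

section HilbertModule

variable (A : Type*) {Y : Type*} [NonUnitalCStarAlgebra A] [PartialOrder A] [StarOrderedRing A]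
  [NormedAddCommGroup Y] [NormedSpace ℂ Y] [SMul A Y] [CStarModule A Y] [CompleteSpace Y]

/-- The rank one endomorphisms `θ_{x,y}` of the Hilbert `A`-module `Y`: `θ_{x,y} z` is `x` multiplied
by the scalar `⟪y, z⟫ ∈ A`.  (In Mathlib the scalars of a Hilbert C*-module are written on the left
and `⟪y, a • z⟫ = a * ⟪y, z⟫`.) -/
def rankOneEndomorphisms : Set (Y →L[ℂ] Y) :=
  {f | ∃ x y : Y, ∀ z : Y, f z = (inner A y z : A) • x}

/-- The compact endomorphisms of the Hilbert `A`-module `Y`: the operator norm closure of the linear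
span of the rank one endomorphisms. -/
def compactEndomorphisms : Submodule ℂ (Y →L[ℂ] Y) :=
  (Submodule.span ℂ (rankOneEndomorphisms A)).topologicalClosure

/-- A self-adjoint endomorphism of the Hilbert `A`-module `Y`. -/
def IsSelfAdjointEndomorphism (b : Y →L[ℂ] Y) : Prop :=
  ∀ x y : Y, (inner A (b x) y : A) = inner A x (b y)

/-- A submodule `X` of the Hilbert `A`-module `Y` is compactly contained in `Y` if there is a compact
self-adjoint endomorphism of `Y` which acts as the identity on `X`. -/
def CompactlyContainedSubmodule (X : Submodule ℂ Y) : Prop :=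
  ∃ b : Y →L[ℂ] Y, b ∈ compactEndomorphisms A ∧ IsSelfAdjointEndomorphism A b ∧ ∀ x ∈ X, b x = x

variable (Y) in
/-- The Hilbert `A`-module `Y` is countably generated: for some countable set `S` the linear span of
the elements `a • s` with `a ∈ A` and `s ∈ S` is dense. -/
def CountablyGeneratedModule : Prop :=
  ∃ S : Set Y, S.Countable ∧
    (Submodule.span ℂ {z : Y | ∃ a : A, ∃ s ∈ S, z = a • s}).topologicalClosure = ⊤

end HilbertModule

/-! ### Closed two-sided ideals as Hilbert C*-modules -/

/-- A closed two-sided ideal of a C*-algebra. -/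
structure ClosedIdeal (A : Type*) [NonUnitalCStarAlgebra A] extends Submodule ℂ A where
  mul_mem_left' : ∀ (a : A) {x : A}, x ∈ carrier → a * x ∈ carrier
  mul_mem_right' : ∀ (a : A) {x : A}, x ∈ carrier → x * a ∈ carrier
  isClosed' : IsClosed carrier

namespace ClosedIdeal

section

variable {A : Type*} [NonUnitalCStarAlgebra A] (I : ClosedIdeal A)

instance : CompleteSpace I.toSubmodule :=
  IsClosed.completeSpace_coe (hs := I.isClosed')

/-- The action of `A` on a closed ideal by multiplication. -/
instance : SMul A I.toSubmodule := ⟨fun a x => ⟨a * x.1, I.mul_mem_left' a x.2⟩⟩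

/-- A closed ideal of `A` is a Hilbert C*-module over `A`, as a submodule of the Hilbert C*-module
`A`: the inner product is `⟪x, y⟫ = y * star x`. -/
instance [PartialOrder A] [StarOrderedRing A] : CStarModule A I.toSubmodule where
  inner x y := y.1 * star x.1
  inner_add_right {x y z} := add_mul y.1 z.1 (star x.1)
  inner_self_nonneg {x} := mul_star_self_nonneg x.1
  inner_self {x} := (CStarRing.mul_star_self_eq_zero_iff x.1).trans ZeroMemClass.coe_eq_zero
  inner_op_smul_right {a x y} := mul_assoc a y.1 (star x.1)
  inner_smul_right_complex {z x y} := smul_mul_assoc z y.1 (star x.1)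
  star_inner x y := by simp
  norm_eq_sqrt_norm_inner_self x := by
    rw [CStarRing.norm_self_mul_star, Real.sqrt_mul_self (norm_nonneg _)]
    rfl

end

variable {A : Type*} [NonUnitalCStarAlgebra A]

/-- The closed ideal `I` is compactly contained in the closed ideal `J`, written `I ⊂⊂ J`: `I` is
contained in `J`, and the Hilbert C*-module `I` is compactly contained in the Hilbert C*-module `J`.
(The partial order used is the usual order of the C*-algebra `A`.) -/
def CompactlyContained (I J : ClosedIdeal A) : Prop :=
  letI := CStarAlgebra.spectralOrder A
  letI := CStarAlgebra.spectralOrderedRing A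
  I.toSubmodule ≤ J.toSubmodule ∧
    CompactlyContainedSubmodule A (Y := J.toSubmodule) (I.toSubmodule.comap J.toSubmodule.subtype)

/-- The closed ideal `I` is countably generated as a Hilbert C*-module. -/
def CountablyGenerated (I : ClosedIdeal A) : Prop :=
  letI := CStarAlgebra.spectralOrder A
  letI := CStarAlgebra.spectralOrderedRing A
  CountablyGeneratedModule A I.toSubmodule

end ClosedIdeal

infix:50 " ⊂⊂ " => ClosedIdeal.CompactlyContained

/-! ### Tensor products of C*-algebras -/

/-- A C*-tensor product of the C*-algebras `A` and `B`: a C*-algebra `T` which is a completion of the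
algebraic tensor product `A ⊗ B` (for some C*-norm on it). -/
structure CStarTensorProduct (A B T : Type*) [NonUnitalCStarAlgebra A] [NonUnitalCStarAlgebra B]
    [NonUnitalCStarAlgebra T] where
  /-- The inclusion of the algebraic tensor product. -/
  hom : A ⊗[ℂ] B →⋆ₙₐ[ℂ] T
  injective : Function.Injective hom
  denseRange : DenseRange hom

namespace CStarTensorProduct

variable {A B T : Type*} [NonUnitalCStarAlgebra A] [NonUnitalCStarAlgebra B]
    [NonUnitalCStarAlgebra T] (τ : CStarTensorProduct A B T)

/-- The linear span in `T` of the elementary tensors `x ⊗ y` with `x ∈ I` and `y ∈ J`. -/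
def algIdeal (I : ClosedIdeal A) (J : ClosedIdeal B) : Submodule ℂ T :=
  Submodule.span ℂ {t : T | ∃ x ∈ I.toSubmodule, ∃ y ∈ J.toSubmodule, t = τ.hom (x ⊗ₜ[ℂ] y)}

theorem mul_mem_left_aux (I : ClosedIdeal A) (J : ClosedIdeal B) (a t : T)
    (ht : t ∈ (τ.algIdeal I J).topologicalClosure) :
    a * t ∈ (τ.algIdeal I J).topologicalClosure := by
  have hc : IsClosed ((τ.algIdeal I J).topologicalClosure : Set T) :=
    Submodule.isClosed_topologicalClosure _
  refine τ.denseRange.induction_on (p := fun a => a * t ∈ (τ.algIdeal I J).topologicalClosure) a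
    (hc.preimage (by fun_prop)) fun s => ?_
  let F : T → T := fun t => τ.hom s * t
  have : Set.MapsTo F (τ.algIdeal I J : Set T) (τ.algIdeal I J) := by
    intro t ht
    change τ.hom s * t ∈ τ.algIdeal I J
    induction ht using Submodule.span_induction with
    | mem t ht =>
      obtain ⟨x, hx, y, hy, rfl⟩ := ht
      simp only [← map_mul]
      induction s using TensorProduct.induction_on with
      | zero => simp
      | tmul a b =>
        rw [Algebra.TensorProduct.tmul_mul_tmul]
        exact Submodule.subset_span
          ⟨_, I.mul_mem_left' a hx, _, J.mul_mem_left' b hy, rfl⟩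
      | add u v hu hv =>
        rw [add_mul, map_add]
        exact add_mem hu hv
    | zero => simp
    | add u v _ _ hu hv => simpa only [mul_add] using add_mem hu hv
    | smul c u _ hu =>
      simpa only [mul_smul_comm] using (τ.algIdeal I J).smul_mem c hu
  exact map_mem_closure (f := F) (by fun_prop) ht this

theorem mul_mem_right_aux (I : ClosedIdeal A) (J : ClosedIdeal B) (a t : T)
    (ht : t ∈ (τ.algIdeal I J).topologicalClosure) :
    t * a ∈ (τ.algIdeal I J).topologicalClosure := by
  have hc : IsClosed ((τ.algIdeal I J).topologicalClosure : Set T) :=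
    Submodule.isClosed_topologicalClosure _
  refine τ.denseRange.induction_on (p := fun a => t * a ∈ (τ.algIdeal I J).topologicalClosure) a
    (hc.preimage (by fun_prop)) fun s => ?_
  let F : T → T := fun t => t * τ.hom s
  have : Set.MapsTo F (τ.algIdeal I J : Set T) (τ.algIdeal I J) := by
    intro t ht
    change t * τ.hom s ∈ τ.algIdeal I J
    induction ht using Submodule.span_induction with
    | mem t ht =>
      obtain ⟨x, hx, y, hy, rfl⟩ := ht
      simp only [← map_mul]
      induction s using TensorProduct.induction_on with
      | zero => simp
      | tmul a b =>
        rw [Algebra.TensorProduct.tmul_mul_tmul]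
        exact Submodule.subset_span
          ⟨_, I.mul_mem_right' a hx, _, J.mul_mem_right' b hy, rfl⟩
      | add u v hu hv =>
        rw [mul_add, map_add]
        exact add_mem hu hv
    | zero => simp
    | add u v _ _ hu hv => simpa only [add_mul] using add_mem hu hv
    | smul c u _ hu =>
      simpa only [smul_mul_assoc] using (τ.algIdeal I J).smul_mem c hu
  exact map_mem_closure (f := F) (by fun_prop) ht this

/-- The tensor product `I ⊗ J` of two closed ideals: the closure of the algebraic tensor product of
`I` and `J` in the C*-tensor product `T` of `A` and `B`, a closed ideal of `T`. -/
def ideal (I : ClosedIdeal A) (J : ClosedIdeal B) : ClosedIdeal T where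
  toSubmodule := (τ.algIdeal I J).topologicalClosure
  mul_mem_left' a _ hx := τ.mul_mem_left_aux I J a _ hx
  mul_mem_right' a _ hx := τ.mul_mem_right_aux I J a _ hx
  isClosed' := Submodule.isClosed_topologicalClosure _

/-- The elementary tensor `x ⊗ y ∈ I ⊗ J` of `x ∈ I` and `y ∈ J`. -/
def tmul {I : ClosedIdeal A} {J : ClosedIdeal B} (x : I.toSubmodule) (y : J.toSubmodule) :
    (τ.ideal I J).toSubmodule :=
  ⟨τ.hom (x.1 ⊗ₜ[ℂ] y.1),
    Submodule.le_topologicalClosure _ (Submodule.subset_span ⟨x.1, x.2, y.1, y.2, rfl⟩)⟩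

/-- The Hilbert `T`-module `I ⊗ J` is the external tensor product of the Hilbert modules `I` and `J`:
its inner product is determined by `⟪x₁ ⊗ y₁, x₂ ⊗ y₂⟫ = ⟪x₁, x₂⟫ ⊗ ⟪y₁, y₂⟫`. -/
theorem inner_tmul [PartialOrder A] [StarOrderedRing A] [PartialOrder B] [StarOrderedRing B]
    [PartialOrder T] [StarOrderedRing T] {I : ClosedIdeal A} {J : ClosedIdeal B}
    (x₁ x₂ : I.toSubmodule) (y₁ y₂ : J.toSubmodule) :
    (inner T (τ.tmul x₁ y₁) (τ.tmul x₂ y₂) : T) =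
      τ.hom ((inner A x₁ x₂ : A) ⊗ₜ[ℂ] (inner B y₁ y₂ : B)) := by
  change τ.hom (x₂.1 ⊗ₜ[ℂ] y₂.1) * star (τ.hom (x₁.1 ⊗ₜ[ℂ] y₁.1)) =
    τ.hom ((x₂.1 * star x₁.1) ⊗ₜ[ℂ] (y₂.1 * star y₁.1))
  rw [← map_star, ← map_mul, TensorProduct.star_tmul, Algebra.TensorProduct.tmul_mul_tmul]

end CStarTensorProduct

/-! ### The spatial (minimal) tensor product -/

section Spatial

variable {A B H K : Type*} [NonUnitalCStarAlgebra A] [NonUnitalCStarAlgebra B]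
  [NormedAddCommGroup H] [InnerProductSpace ℂ H] [CompleteSpace H]
  [NormedAddCommGroup K] [InnerProductSpace ℂ K] [CompleteSpace K]

variable (H K) in
/-- The Hilbert space tensor product of `H` and `K`: the completion of their algebraic tensor product
in the norm of the inner product `⟪x ⊗ y, x' ⊗ y'⟫ = ⟪x, x'⟫ ⟪y, y'⟫`. -/
def HilbertTensor : Type _ := UniformSpace.Completion (H ⊗[ℂ] K)

instance : NormedAddCommGroup (HilbertTensor H K) :=
  inferInstanceAs (NormedAddCommGroup (UniformSpace.Completion (H ⊗[ℂ] K)))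

instance : InnerProductSpace ℂ (HilbertTensor H K) :=
  inferInstanceAs (InnerProductSpace ℂ (UniformSpace.Completion (H ⊗[ℂ] K)))

instance : CompleteSpace (HilbertTensor H K) :=
  inferInstanceAs (CompleteSpace (UniformSpace.Completion (H ⊗[ℂ] K)))

variable (H K) in
/-- The inclusion of the algebraic tensor product into the Hilbert space tensor product. -/
def toHilbertTensor : H ⊗[ℂ] K →ₗᵢ[ℂ] HilbertTensor H K :=
  UniformSpace.Completion.toComplₗᵢ

/-- The operator `a ⊗ b` on the Hilbert space tensor product of `H` and `K`, with
`(a ⊗ b) (x ⊗ y) = a x ⊗ b y`. -/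
def opTensor (a : H →L[ℂ] H) (b : K →L[ℂ] K) : HilbertTensor H K →L[ℂ] HilbertTensor H K :=
  ContinuousLinearMap.completion (TensorProduct.mapL a b)

theorem denseRange_toHilbertTensor : DenseRange (toHilbertTensor H K) :=
  UniformSpace.Completion.denseRange_coe

theorem opTensor_coe (a : H →L[ℂ] H) (b : K →L[ℂ] K) (z : H ⊗[ℂ] K) :
    opTensor a b (toHilbertTensor H K z) = toHilbertTensor H K (TensorProduct.mapL a b z) :=
  ContinuousLinearMap.completion_apply_coe (TensorProduct.mapL a b) z

theorem op_ext {S T : HilbertTensor H K →L[ℂ] HilbertTensor H K}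
    (h : ∀ x y, S (toHilbertTensor H K (x ⊗ₜ[ℂ] y)) = T (toHilbertTensor H K (x ⊗ₜ[ℂ] y))) :
    S = T := by
  ext z
  refine denseRange_toHilbertTensor.induction_on z (isClosed_eq S.continuous T.continuous) fun z => ?_
  induction z using TensorProduct.induction_on with
  | zero => simp
  | tmul x y => exact h x y
  | add u v hu hv => simp [hu, hv]

theorem opTensor_mul (a a' : H →L[ℂ] H) (b b' : K →L[ℂ] K) :
    opTensor (a * a') (b * b') = opTensor a b * opTensor a' b' :=
  op_ext fun x y => by simp [opTensor_coe]

theorem star_opTensor (a : H →L[ℂ] H) (b : K →L[ℂ] K) :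
    star (opTensor a b) = opTensor (star a) (star b) := by
  rw [ContinuousLinearMap.star_eq_adjoint, eq_comm, ContinuousLinearMap.eq_adjoint_iff]
  intro u v
  refine denseRange_toHilbertTensor.induction_on₂
    (p := fun u v => inner ℂ (opTensor (star a) (star b) u) v = inner ℂ u (opTensor a b v))
    (isClosed_eq (by fun_prop) (by fun_prop)) (fun u v => ?_) u v
  simp only [opTensor_coe, LinearIsometry.inner_map_map]
  induction u using TensorProduct.induction_on with
  | zero => simp
  | add u u' hu hu' => rw [map_add, inner_add_left, inner_add_left, hu, hu']
  | tmul x y =>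
    induction v using TensorProduct.induction_on with
    | zero => simp
    | add v v' hv hv' => rw [map_add, inner_add_right, inner_add_right, hv, hv']
    | tmul x' y' =>
      simp [ContinuousLinearMap.star_eq_adjoint, ContinuousLinearMap.adjoint_inner_left]

/-- For representations `π` of `A` on `H` and `ρ` of `B` on `K`, the representation `π ⊗ ρ` of the
algebraic tensor product `A ⊗ B` on the Hilbert space tensor product, `a ⊗ b ↦ π a ⊗ ρ b`. -/
def tensorRep (π : A →⋆ₙₐ[ℂ] (H →L[ℂ] H)) (ρ : B →⋆ₙₐ[ℂ] (K →L[ℂ] K)) :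
    A ⊗[ℂ] B →⋆ₙₐ[ℂ] (HilbertTensor H K →L[ℂ] HilbertTensor H K) :=
  let f : A ⊗[ℂ] B →ₗ[ℂ] (HilbertTensor H K →L[ℂ] HilbertTensor H K) :=
    TensorProduct.lift (LinearMap.mk₂ ℂ (fun a b => opTensor (π a) (ρ b))
      (fun a a' b => op_ext fun x y => by simp [opTensor_coe, TensorProduct.add_tmul])
      (fun c a b => op_ext fun x y => by
        simp [opTensor_coe, ← TensorProduct.smul_tmul', - TensorProduct.tmul_smul])
      (fun a b b' => op_ext fun x y => by simp [opTensor_coe, TensorProduct.tmul_add])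
      (fun c a b => op_ext fun x y => by simp [opTensor_coe]))
  { f with
    map_zero' := f.map_zero
    map_mul' := by
      intro s t
      change f (s * t) = f s * f t
      induction s using TensorProduct.induction_on with
      | zero => simp
      | add u v hu hv => rw [add_mul, map_add, map_add, hu, hv, add_mul]
      | tmul a b =>
        induction t using TensorProduct.induction_on with
        | zero => simp
        | add u v hu hv => rw [mul_add, map_add, map_add, hu, hv, mul_add]
        | tmul a' b' => simp [f, opTensor_mul]
    map_star' := by
      intro t
      change f (star t) = star (f t)
      induction t using TensorProduct.induction_on with
      | zero => simp
      | add u v hu hv => rw [star_add, map_add, map_add, hu, hv, star_add]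
      | tmul a b => simp [f, star_opTensor, map_star] }

@[simp] theorem tensorRep_tmul (π : A →⋆ₙₐ[ℂ] (H →L[ℂ] H)) (ρ : B →⋆ₙₐ[ℂ] (K →L[ℂ] K)) (a : A)
    (b : B) : tensorRep π ρ (a ⊗ₜ[ℂ] b) = opTensor (π a) (ρ b) :=
  rfl

theorem tensorRep_injective (π : A →⋆ₙₐ[ℂ] (H →L[ℂ] H)) (ρ : B →⋆ₙₐ[ℂ] (K →L[ℂ] K))
    (hπ : Function.Injective π) (hρ : Function.Injective ρ) :
    Function.Injective (tensorRep π ρ) := by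
  classical
  rw [injective_iff_map_eq_zero]
  intro t ht
  -- the functionals `a ↦ ⟪x', π a x⟫` separate the points of `A`
  let φ : H → H → A →ₗ[ℂ] ℂ := fun x' x =>
    { toFun := fun a => inner ℂ x' (π a x)
      map_add' := fun a b => by simp
      map_smul' := fun c a => by simp }
  let G : H → H ⊗[ℂ] K →ₗ[ℂ] K := fun x' =>
    (TensorProduct.lid ℂ K).toLinearMap ∘ₗ
      TensorProduct.map (innerSL ℂ x').toLinearMap LinearMap.id
  let Φ : H → H → A ⊗[ℂ] B →ₗ[ℂ] B := fun x' x =>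
    (TensorProduct.lid ℂ B).toLinearMap ∘ₗ TensorProduct.map (φ x' x) LinearMap.id
  have key : ∀ (x' x : H) (y : K) (s : A ⊗[ℂ] B), ∃ z : H ⊗[ℂ] K,
      tensorRep π ρ s (toHilbertTensor H K (x ⊗ₜ[ℂ] y)) = toHilbertTensor H K z ∧
      G x' z = ρ (Φ x' x s) y := by
    intro x' x y s
    induction s using TensorProduct.induction_on with
    | zero => exact ⟨0, by simp⟩
    | tmul a b =>
      exact ⟨π a x ⊗ₜ[ℂ] ρ b y, by simp [opTensor_coe], by simp [G, Φ, φ]⟩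
    | add u v hu hv =>
      obtain ⟨z, h1, h2⟩ := hu
      obtain ⟨w, h3, h4⟩ := hv
      refine ⟨z + w, ?_, ?_⟩
      · rw [map_add, add_apply, h1, h3, map_add]
      · rw [map_add, map_add, map_add, add_apply, h2, h4]
  have h0 : ∀ x' x, Φ x' x t = 0 := by
    intro x' x
    refine (injective_iff_map_eq_zero ρ).1 hρ _ (ContinuousLinearMap.ext fun y => ?_)
    obtain ⟨z, h1, h2⟩ := key x' x y t
    rw [ht] at h1
    have hz : z = 0 := (toHilbertTensor H K).injective (by simpa using h1.symm)
    rw [← h2, hz, map_zero, zero_apply]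
  let 𝒞 := Module.Basis.ofVectorSpace ℂ B
  have hrepr : ∀ (x' x : H) (s : A ⊗[ℂ] B) (i),
      𝒞.repr (Φ x' x s) i = φ x' x (TensorProduct.equivFinsuppOfBasisRight 𝒞 s i) := by
    intro x' x s i
    induction s using TensorProduct.induction_on with
    | zero => simp
    | tmul a b => simp [Φ, mul_comm]
    | add u v hu hv => simp only [map_add, Finsupp.add_apply, hu, hv]
  apply (TensorProduct.equivFinsuppOfBasisRight (M := A) 𝒞).injective
  rw [map_zero]
  ext i
  refine hπ (ContinuousLinearMap.ext fun x => ext_inner_left ℂ fun x' => ?_)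
  have := hrepr x' x t i
  rw [h0] at this
  simpa [φ] using this.symm

/-- The underlying algebra of the spatial tensor product of `A` and `B`, formed in the
representations `π` and `ρ`: the norm closure of the image of the algebraic tensor product in the
bounded operators on the Hilbert space tensor product. -/
def spatialAlgebra (π : A →⋆ₙₐ[ℂ] (H →L[ℂ] H)) (ρ : B →⋆ₙₐ[ℂ] (K →L[ℂ] K)) :
    NonUnitalStarSubalgebra ℂ (HilbertTensor H K →L[ℂ] HilbertTensor H K) :=
  (NonUnitalStarAlgHom.range (tensorRep π ρ)).topologicalClosure

instance (π : A →⋆ₙₐ[ℂ] (H →L[ℂ] H)) (ρ : B →⋆ₙₐ[ℂ] (K →L[ℂ] K)) :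
    NonUnitalCStarAlgebra (spatialAlgebra π ρ) :=
  NonUnitalStarSubalgebra.nonUnitalCStarAlgebra _
    (h_closed := NonUnitalStarSubalgebra.isClosed_topologicalClosure
      (NonUnitalStarAlgHom.range (tensorRep π ρ)))

theorem tensorRep_mem (π : A →⋆ₙₐ[ℂ] (H →L[ℂ] H)) (ρ : B →⋆ₙₐ[ℂ] (K →L[ℂ] K)) (t : A ⊗[ℂ] B) :
    tensorRep π ρ t ∈ spatialAlgebra π ρ :=
  NonUnitalStarSubalgebra.le_topologicalClosure _ ⟨t, rfl⟩

/-- The spatial (minimal) tensor product of the C*-algebras `A` and `B`, formed in the faithful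
representations `π` and `ρ`. -/
def spatialTensorProduct (π : A →⋆ₙₐ[ℂ] (H →L[ℂ] H)) (ρ : B →⋆ₙₐ[ℂ] (K →L[ℂ] K))
    (hπ : Function.Injective π) (hρ : Function.Injective ρ) :
    CStarTensorProduct A B (spatialAlgebra π ρ) where
  hom :=
    { toFun := fun t => ⟨tensorRep π ρ t, tensorRep_mem π ρ t⟩
      map_smul' := fun c t => Subtype.ext (map_smul (tensorRep π ρ) c t)
      map_zero' := Subtype.ext (map_zero (tensorRep π ρ))
      map_add' := fun s t => Subtype.ext (map_add (tensorRep π ρ) s t)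
      map_mul' := fun s t => Subtype.ext (map_mul (tensorRep π ρ) s t)
      map_star' := fun t => Subtype.ext (map_star (tensorRep π ρ) t) }
  injective s t h := tensorRep_injective π ρ hπ hρ (congrArg Subtype.val h)
  denseRange := by
    intro z
    rw [Topology.IsInducing.subtypeVal.closure_eq_preimage_closure_image, ← Set.range_comp]
    exact z.2

end Spatial

end HilbertIdeal

end

/-!
A closed two-sided ideal `J` is self-adjoint and has an approximate unit, so right multiplication
identifies `J` isometrically with the compact endomorphisms of the Hilbert module `J`. Hence
`I ⊂⊂ J` means that `I ⊆ J` and some self-adjoint `c ∈ J` satisfies `x * c = x` for all `x ∈ I`.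
If `c` and `d` are such elements for `I₁ ⊂⊂ J₁` and `I₂ ⊂⊂ J₂`, then `c ⊗ d` is one for
`I₁ ⊗ I₂ ⊂⊂ J₁ ⊗ J₂`. Likewise, the tensors `s ⊗ r` of generators of `I` and `J` generate `I ⊗ J`,
because the elementary tensor is separately continuous for every C*-norm.
-/

namespace HilbertIdeal

theorem tendsto_mul_left_of_tendsto_star_mul_self_mul {A : Type*} [NonUnitalNormedRing A]
    [StarRing A] [CStarRing A] {l : Filter A} {x : A} (hl : ∀ᶠ u in l, ‖u‖ ≤ 1)
    (hx : Filter.Tendsto (star x * x * ·) l (nhds (star x * x))) :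
    Filter.Tendsto (x * ·) l (nhds x) := by
  have norm_sq_le : ∀ᶠ u in l, ‖x * u - x‖ ^ 2 ≤ 2 * ‖star x * x * u - star x * x‖ := by
    filter_upwards [hl] with u hu
    set w := star x * x * u - star x * x
    calc ‖x * u - x‖ ^ 2 = ‖star u * w - w‖ := by
          rw [sq, ← CStarRing.norm_star_mul_self]
          congr 1
          simp only [w, star_sub, star_mul]
          noncomm_ring
      _ ≤ ‖star u‖ * ‖w‖ + ‖w‖ := (norm_sub_le _ _).trans (by gcongr; exact norm_mul_le _ _)
      _ ≤ 1 * ‖w‖ + ‖w‖ := by rw [norm_star]; gcongr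
      _ = 2 * ‖w‖ := by ring
  have sq_tendsto : Filter.Tendsto (fun u => ‖x * u - x‖ ^ 2) l (nhds 0) :=
    squeeze_zero' (.of_forall fun _ => sq_nonneg _) norm_sq_le
      (by simpa using (tendsto_iff_norm_sub_tendsto_zero.mp hx).const_mul 2)
  rw [tendsto_iff_norm_sub_tendsto_zero]
  simpa using sq_tendsto.sqrt

theorem map_mem_of_mem_topologicalClosure_span {R E F G : Type*} [CommSemiring R]
    [AddCommMonoid E] [Module R E] [TopologicalSpace E] [ContinuousAdd E] [ContinuousConstSMul R E]
    [AddCommMonoid F] [Module R F] [TopologicalSpace F] [ContinuousAdd F] [ContinuousConstSMul R F]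
    [AddCommMonoid G] [Module R G] [TopologicalSpace G] {f : E →ₗ[R] F →ₗ[R] G}
    (hf_left : ∀ y, Continuous fun x => f x y) (hf_right : ∀ x, Continuous (f x))
    {P : Submodule R G} (hP : IsClosed (P : Set G)) {s : Set E} {t : Set F}
    (h : ∀ x ∈ s, ∀ y ∈ t, f x y ∈ P) {x : E} {y : F}
    (hx : x ∈ (Submodule.span R s).topologicalClosure)
    (hy : y ∈ (Submodule.span R t).topologicalClosure) : f x y ∈ P := by
  have mem_right {x₀ : E} (hx₀ : x₀ ∈ s) : f x₀ y ∈ P :=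
    Submodule.topologicalClosure_minimal _ (t := P.comap (f x₀))
      (Submodule.span_le.mpr (h x₀ hx₀)) (hP.preimage (hf_right x₀)) hy
  exact Submodule.topologicalClosure_minimal _ (t := P.comap (f.flip y))
    (Submodule.span_le.mpr fun _ => mem_right) (hP.preimage (hf_left y)) hx

theorem continuous_apply_of_nonneg {A B T : Type*} [NonUnitalCStarAlgebra A] [PartialOrder A]
    [StarOrderedRing A] [NonUnitalCStarAlgebra B] [PartialOrder B] [StarOrderedRing B]
    [NonUnitalCStarAlgebra T] [PartialOrder T] [StarOrderedRing T] {f : A →ₗ[ℂ] B →ₗ[ℂ] T}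
    (hf : ∀ a, 0 ≤ a → ∀ b, 0 ≤ b → 0 ≤ f a b) (a : A) : Continuous (f a) := by
  have ha : a ∈ Submodule.span ℂ {a : A | 0 ≤ a} := by
    rw [CStarAlgebra.span_nonneg]
    exact Submodule.mem_top
  induction ha using Submodule.span_induction with
  | mem a ha => exact map_continuous (PositiveLinearMap.mk₀ (f a) (hf a ha))
  | zero =>
    rw [map_zero]
    exact continuous_zero
  | add a a' _ _ h h' =>
    rw [map_add]
    exact h.add h'
  | smul c a _ h => simpa using h.const_smul c

namespace ClosedIdeal

variable {A : Type*} [NonUnitalCStarAlgebra A] (J : ClosedIdeal A)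

/-- The C*-subalgebra `J ∩ J*` of `A`. It equals `J`, but it is visibly a C*-algebra, so its
approximate unit can be used to prove that `J` is self-adjoint. -/
def starCore : NonUnitalStarSubalgebra ℂ A where
  carrier := {x | x ∈ J.toSubmodule ∧ star x ∈ J.toSubmodule}
  add_mem' hx hy := ⟨add_mem hx.1 hy.1, by simpa using add_mem hx.2 hy.2⟩
  zero_mem' := by simp
  smul_mem' r x hx := ⟨J.smul_mem r hx.1, by simpa using J.smul_mem (star r) hx.2⟩
  mul_mem' hx hy := ⟨J.mul_mem_left' _ hy.1, by simpa using J.mul_mem_left' _ hx.2⟩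
  star_mem' hx := ⟨hx.2, by simpa using hx.1⟩

theorem isClosed_starCore : IsClosed (J.starCore : Set A) :=
  J.isClosed'.inter (J.isClosed'.preimage continuous_star)

theorem star_mul_self_mem_starCore {x : A} (hx : x ∈ J.toSubmodule) :
    star x * x ∈ J.starCore :=
  ⟨J.mul_mem_left' _ hx, by simpa using J.mul_mem_left' (star x) hx⟩

theorem mem_closure_mul_starCore {x : A} (hx : x ∈ J.toSubmodule) :
    x ∈ closure ((x * ·) '' (J.starCore : Set A)) := by
  let _ : NonUnitalCStarAlgebra J.starCore :=
    NonUnitalStarSubalgebra.nonUnitalCStarAlgebra _ (h_closed := J.isClosed_starCore)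
  let _ := CStarAlgebra.spectralOrder J.starCore
  let _ := CStarAlgebra.spectralOrderedRing J.starCore
  have unit := CStarAlgebra.increasingApproximateUnit J.starCore
  let l := (CStarAlgebra.approximateUnit J.starCore).map ((↑) : J.starCore → A)
  have norm_le : ∀ᶠ u in l, ‖u‖ ≤ 1 := Filter.eventually_map.mpr unit.eventually_norm
  have tendsto_star_mul_self :
      Filter.Tendsto (star x * x * ·) l (nhds (star x * x)) :=
    Filter.tendsto_map'_iff.mpr <| (continuous_subtype_val.tendsto _).comp <|
      unit.tendsto_mul_left ⟨star x * x, J.star_mul_self_mem_starCore hx⟩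
  refine mem_closure_of_tendsto
    (tendsto_mul_left_of_tendsto_star_mul_self_mul norm_le tendsto_star_mul_self) ?_
  exact Filter.eventually_map.mpr (.of_forall fun u => ⟨u, u.2, rfl⟩)

theorem star_mem {x : A} (hx : x ∈ J.toSubmodule) : star x ∈ J.toSubmodule := by
  refine J.isClosed'.closure_subset
    (map_mem_closure continuous_star (J.mem_closure_mul_starCore hx) ?_)
  rintro _ ⟨u, hu, rfl⟩
  rw [star_mul]
  exact J.mul_mem_right' _ hu.2

theorem mem_closure_star_mul {x : A} (hx : x ∈ J.toSubmodule) :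
    x ∈ closure {z | ∃ y ∈ J.toSubmodule, z = star y * x} := by
  rw [← star_star x]
  refine map_mem_closure continuous_star (J.mem_closure_mul_starCore (J.star_mem hx)) ?_
  rintro _ ⟨u, hu, rfl⟩
  exact ⟨u, hu.1, by simp⟩

/-- Right multiplication by the elements of a closed ideal `J`, as an isometric embedding of `J`
into the bounded operators on `J`. -/
noncomputable def mulRight : J.toSubmodule →ₗᵢ[ℂ] (J.toSubmodule →L[ℂ] J.toSubmodule) where
  toFun c := (((ContinuousLinearMap.mul ℂ A).flip c).comp J.toSubmodule.subtypeL).codRestrict _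
    fun x => J.mul_mem_right' c x.2
  map_add' c d := ContinuousLinearMap.ext fun x => Subtype.ext (mul_add x.1 c.1 d.1)
  map_smul' r c := ContinuousLinearMap.ext fun x => Subtype.ext (mul_smul_comm r x.1 c.1)
  norm_map' c := by
    refine ContinuousLinearMap.opNorm_eq_of_bounds (norm_nonneg c)
      (fun x => (norm_mul_le x.1 c.1).trans_eq (mul_comm _ _)) fun M hM h => ?_
    rcases eq_or_ne c 0 with rfl | hc
    · simpa using hM
    have norm_star_mul_le : ‖star c.1 * c.1‖ ≤ M * ‖star c.1‖ := h ⟨star c.1, J.star_mem c.2⟩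
    rw [CStarRing.norm_star_mul_self, norm_star] at norm_star_mul_le
    exact le_of_mul_le_mul_right norm_star_mul_le ((norm_pos_iff (a := c)).mpr hc)

@[simp]
theorem coe_mulRight_apply (c x : J.toSubmodule) : (J.mulRight c x : A) = x * c :=
  rfl

section

variable [PartialOrder A] [StarOrderedRing A]

theorem inner_def (x y : J.toSubmodule) : (inner A x y : A) = y * star (x : A) :=
  rfl

theorem compactEndomorphisms_eq_range_mulRight :
    compactEndomorphisms (Y := J.toSubmodule) A = LinearMap.range J.mulRight.toLinearMap := by
  have isClosed_range : IsClosed (Set.range J.mulRight) :=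
    J.mulRight.isometry.isUniformInducing.isComplete_range.isClosed
  apply le_antisymm
  · refine Submodule.topologicalClosure_minimal _ (Submodule.span_le.mpr ?_) isClosed_range
    rintro f ⟨x, y, hf⟩
    refine ⟨⟨star y.1 * x.1, J.mul_mem_left' _ x.2⟩, ContinuousLinearMap.ext fun z => ?_⟩
    rw [hf z]
    exact Subtype.ext (mul_assoc z.1 (star y.1) x.1).symm
  · rintro _ ⟨c, rfl⟩
    have mem_closure :
        c ∈ closure {d : J.toSubmodule | ∃ y ∈ J.toSubmodule, (d : A) = star y * c} := by
      rw [Topology.IsInducing.subtypeVal.closure_eq_preimage_closure_image]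
      refine closure_mono ?_ (J.mem_closure_star_mul c.2)
      rintro _ ⟨y, hy, rfl⟩
      exact ⟨⟨star y * c, J.mul_mem_left' _ c.2⟩, ⟨y, hy, rfl⟩, rfl⟩
    refine map_mem_closure J.mulRight.continuous mem_closure fun d ⟨y, hy, hd⟩ =>
      Submodule.subset_span ⟨c, ⟨y, hy⟩, fun z => Subtype.ext ?_⟩
    exact (congrArg (z.1 * ·) hd).trans (mul_assoc z.1 (star y) c.1).symm

theorem isSelfAdjointEndomorphism_mulRight_iff {c : J.toSubmodule} :
    IsSelfAdjointEndomorphism A (J.mulRight c) ↔ IsSelfAdjoint (c : A) := by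
  refine ⟨fun h => ?_, fun h x y => by simp [inner_def, mul_assoc, h.star_eq]⟩
  let c' : J.toSubmodule := ⟨star c.1, J.star_mem c.2⟩
  have inner_eq (x y : J.toSubmodule) :
      (inner A x (J.mulRight c' y) : A) = inner A x (J.mulRight c y) := by
    rw [← h x y]
    simp [inner_def, c', mul_assoc]
  have mulRight_eq : J.mulRight c' = J.mulRight c := by
    ext1 y
    rw [← sub_eq_zero, ← CStarModule.inner_self (A := A), CStarModule.inner_sub_right, inner_eq,
      sub_self]
  exact congrArg Subtype.val (J.mulRight.injective mulRight_eq)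

end

theorem compactlyContained_iff {I J : ClosedIdeal A} :
    I ⊂⊂ J ↔ I.toSubmodule ≤ J.toSubmodule ∧
      ∃ c ∈ J.toSubmodule, IsSelfAdjoint c ∧ ∀ x ∈ I.toSubmodule, x * c = x := by
  let _ := CStarAlgebra.spectralOrder A
  let _ := CStarAlgebra.spectralOrderedRing A
  refine and_congr_right fun hIJ => ?_
  rw [CompactlyContainedSubmodule, compactEndomorphisms_eq_range_mulRight]
  constructor
  · rintro ⟨_, ⟨c, rfl⟩, hc, hcI⟩
    exact ⟨c, c.2, J.isSelfAdjointEndomorphism_mulRight_iff.mp hc,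
      fun x hx => congrArg Subtype.val (hcI ⟨x, hIJ hx⟩ hx)⟩
  · rintro ⟨c, hcJ, hc, hcI⟩
    exact ⟨J.mulRight ⟨c, hcJ⟩, ⟨_, rfl⟩, J.isSelfAdjointEndomorphism_mulRight_iff.mpr hc,
      fun x hx => Subtype.ext (hcI x hx)⟩

end ClosedIdeal

namespace CStarTensorProduct

variable {A B T : Type*} [NonUnitalCStarAlgebra A] [NonUnitalCStarAlgebra B]
  [NonUnitalCStarAlgebra T] (τ : CStarTensorProduct A B T)

theorem hom_tmul_mul_hom_tmul (a a' : A) (b b' : B) :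
    τ.hom (a ⊗ₜ[ℂ] b) * τ.hom (a' ⊗ₜ[ℂ] b') = τ.hom ((a * a') ⊗ₜ[ℂ] (b * b')) := by
  rw [← map_mul, Algebra.TensorProduct.tmul_mul_tmul]

theorem star_hom_tmul (a : A) (b : B) :
    star (τ.hom (a ⊗ₜ[ℂ] b)) = τ.hom (star a ⊗ₜ[ℂ] star b) := by
  rw [← map_star, TensorProduct.star_tmul]

theorem hom_tmul_nonneg [PartialOrder A] [StarOrderedRing A] [PartialOrder B] [StarOrderedRing B]
    [PartialOrder T] [StarOrderedRing T] {a : A} {b : B} (ha : 0 ≤ a) (hb : 0 ≤ b) :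
    0 ≤ τ.hom (a ⊗ₜ[ℂ] b) := by
  obtain ⟨a, rfl⟩ := CStarAlgebra.nonneg_iff_eq_star_mul_self.mp ha
  obtain ⟨b, rfl⟩ := CStarAlgebra.nonneg_iff_eq_star_mul_self.mp hb
  rw [← hom_tmul_mul_hom_tmul, ← star_hom_tmul]
  exact star_mul_self_nonneg _

/-- The bilinear map `(a, b) ↦ a ⊗ b` into a C*-tensor product. -/
noncomputable def bilin : A →ₗ[ℂ] B →ₗ[ℂ] T :=
  (TensorProduct.mk ℂ A B).compr₂ (τ.hom : A ⊗[ℂ] B →ₗ[ℂ] T)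

theorem continuous_hom_tmul_right (a : A) : Continuous fun b : B => τ.hom (a ⊗ₜ[ℂ] b) := by
  let _ := CStarAlgebra.spectralOrder A
  let _ := CStarAlgebra.spectralOrderedRing A
  let _ := CStarAlgebra.spectralOrder B
  let _ := CStarAlgebra.spectralOrderedRing B
  let _ := CStarAlgebra.spectralOrder T
  let _ := CStarAlgebra.spectralOrderedRing T
  exact continuous_apply_of_nonneg (f := τ.bilin) (fun _ ha _ hb => τ.hom_tmul_nonneg ha hb) a

theorem continuous_hom_tmul_left (b : B) : Continuous fun a : A => τ.hom (a ⊗ₜ[ℂ] b) := by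
  let _ := CStarAlgebra.spectralOrder A
  let _ := CStarAlgebra.spectralOrderedRing A
  let _ := CStarAlgebra.spectralOrder B
  let _ := CStarAlgebra.spectralOrderedRing B
  let _ := CStarAlgebra.spectralOrder T
  let _ := CStarAlgebra.spectralOrderedRing T
  exact continuous_apply_of_nonneg (f := τ.bilin.flip) (fun _ hb _ ha => τ.hom_tmul_nonneg ha hb) b

section

variable {I : ClosedIdeal A} {J : ClosedIdeal B}

theorem hom_tmul_mem_ideal {x : A} {y : B} (hx : x ∈ I.toSubmodule) (hy : y ∈ J.toSubmodule) :
    τ.hom (x ⊗ₜ[ℂ] y) ∈ (τ.ideal I J).toSubmodule :=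
  (τ.tmul ⟨x, hx⟩ ⟨y, hy⟩).2

theorem ideal_le {P : Submodule ℂ T} (hP : IsClosed (P : Set T))
    (h : ∀ x ∈ I.toSubmodule, ∀ y ∈ J.toSubmodule, τ.hom (x ⊗ₜ[ℂ] y) ∈ P) :
    (τ.ideal I J).toSubmodule ≤ P := by
  refine Submodule.topologicalClosure_minimal _ (Submodule.span_le.mpr ?_) hP
  rintro _ ⟨x, hx, y, hy, rfl⟩
  exact h x hx y hy

theorem eq_top_of_tmul_mem {P : Submodule ℂ (τ.ideal I J).toSubmodule}
    (hP : IsClosed (P : Set (τ.ideal I J).toSubmodule)) (h : ∀ x y, τ.tmul x y ∈ P) : P = ⊤ := by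
  let P' : Submodule ℂ T := P.map (τ.ideal I J).toSubmodule.subtype
  have isClosed_P' : IsClosed (P' : Set T) :=
    (τ.ideal I J).isClosed'.isClosedEmbedding_subtypeVal.isClosedMap _ hP
  have ideal_le_P' : (τ.ideal I J).toSubmodule ≤ P' :=
    τ.ideal_le isClosed_P' fun x hx y hy => ⟨_, h ⟨x, hx⟩ ⟨y, hy⟩, rfl⟩
  refine Submodule.eq_top_iff'.mpr fun z => ?_
  obtain ⟨w, hw, hwz⟩ := ideal_le_P' z.2
  rwa [← Subtype.ext hwz]

variable (I J) in
/-- The bilinear map `(x, y) ↦ x ⊗ y` from a pair of closed ideals to their tensor product. -/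
def tmulBilin : I.toSubmodule →ₗ[ℂ] J.toSubmodule →ₗ[ℂ] (τ.ideal I J).toSubmodule :=
  LinearMap.mk₂ ℂ τ.tmul
    (fun x x' y => Subtype.ext (τ.bilin.map_add₂ x.1 x'.1 y.1))
    (fun c x y => Subtype.ext (τ.bilin.map_smul₂ c x.1 y.1))
    (fun x y y' => Subtype.ext ((τ.bilin x.1).map_add y.1 y'.1))
    (fun c x y => Subtype.ext ((τ.bilin x.1).map_smul c y.1))

theorem tmul_smul_smul (a : A) (b : B) (x : I.toSubmodule) (y : J.toSubmodule) :
    τ.tmul (a • x) (b • y) = τ.hom (a ⊗ₜ[ℂ] b) • τ.tmul x y :=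
  Subtype.ext (τ.hom_tmul_mul_hom_tmul a x.1 b y.1).symm

theorem countablyGenerated_ideal (hI : I.CountablyGenerated) (hJ : J.CountablyGenerated) :
    (τ.ideal I J).CountablyGenerated := by
  obtain ⟨S, hS, hSI⟩ := hI
  obtain ⟨R, hR, hRJ⟩ := hJ
  refine ⟨Set.image2 τ.tmul S R, hS.image2 hR _,
    τ.eq_top_of_tmul_mem (Submodule.isClosed_topologicalClosure _) fun x y => ?_⟩
  refine map_mem_of_mem_topologicalClosure_span (f := τ.tmulBilin I J)
    (fun y => ((τ.continuous_hom_tmul_left y.1).comp continuous_subtype_val).subtype_mk _)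
    (fun x => ((τ.continuous_hom_tmul_right x.1).comp continuous_subtype_val).subtype_mk _)
    (Submodule.isClosed_topologicalClosure _) ?_
    (hSI ▸ Submodule.mem_top) (hRJ ▸ Submodule.mem_top)
  rintro _ ⟨a, s, hs, rfl⟩ _ ⟨b, r, hr, rfl⟩
  exact Submodule.le_topologicalClosure _ <| Submodule.subset_span
    ⟨τ.hom (a ⊗ₜ[ℂ] b), τ.tmul s r, Set.mem_image2_of_mem hs hr, τ.tmul_smul_smul a b s r⟩

end

theorem ideal_mono {I₁ J₁ : ClosedIdeal A} {I₂ J₂ : ClosedIdeal B}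
    (h₁ : I₁.toSubmodule ≤ J₁.toSubmodule) (h₂ : I₂.toSubmodule ≤ J₂.toSubmodule) :
    (τ.ideal I₁ I₂).toSubmodule ≤ (τ.ideal J₁ J₂).toSubmodule :=
  τ.ideal_le (τ.ideal J₁ J₂).isClosed' fun _ hx _ hy => τ.hom_tmul_mem_ideal (h₁ hx) (h₂ hy)

theorem compactlyContained_ideal {I₁ J₁ : ClosedIdeal A} {I₂ J₂ : ClosedIdeal B}
    (h₁ : I₁ ⊂⊂ J₁) (h₂ : I₂ ⊂⊂ J₂) : τ.ideal I₁ I₂ ⊂⊂ τ.ideal J₁ J₂ := by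
  rw [ClosedIdeal.compactlyContained_iff] at h₁ h₂ ⊢
  obtain ⟨hIJ₁, c, hcJ, hc, hcI⟩ := h₁
  obtain ⟨hIJ₂, d, hdJ, hd, hdI⟩ := h₂
  let e := τ.hom (c ⊗ₜ[ℂ] d)
  have he : IsSelfAdjoint e := by
    rw [isSelfAdjoint_iff, star_hom_tmul, hc.star_eq, hd.star_eq]
  let fixed : Submodule ℂ T := LinearMap.eqLocus (LinearMap.mulRight ℂ e) LinearMap.id
  have isClosed_fixed : IsClosed (fixed : Set T) :=
    isClosed_eq (continuous_mul_const e) continuous_id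
  have ideal_le_fixed : (τ.ideal I₁ I₂).toSubmodule ≤ fixed :=
    τ.ideal_le isClosed_fixed fun x hx y hy =>
      (τ.hom_tmul_mul_hom_tmul x c y d).trans (by rw [hcI x hx, hdI y hy]; rfl)
  exact ⟨τ.ideal_mono hIJ₁ hIJ₂, e, τ.hom_tmul_mem_ideal hcJ hdJ, he, fun _ hz => ideal_le_fixed hz⟩

end CStarTensorProduct

end HilbertIdeal

open HilbertIdeal in
theorem corollary4p2_general {A B T : Type*} [NonUnitalCStarAlgebra A] [NonUnitalCStarAlgebra B]
    [NonUnitalCStarAlgebra T] (τ : CStarTensorProduct A B T) {I₁ J₁ : ClosedIdeal A}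
    {I₂ J₂ : ClosedIdeal B} (h₁ : I₁ ⊂⊂ J₁) (h₂ : I₂ ⊂⊂ J₂) :
    (τ.ideal I₁ I₂ ⊂⊂ τ.ideal J₁ J₂) ∧
      (I₁.CountablyGenerated → I₂.CountablyGenerated → (τ.ideal I₁ I₂).CountablyGenerated) ∧
      (J₁.CountablyGenerated → J₂.CountablyGenerated → (τ.ideal J₁ J₂).CountablyGenerated) :=
  ⟨τ.compactlyContained_ideal h₁ h₂, τ.countablyGenerated_ideal, τ.countablyGenerated_ideal⟩

open HilbertIdeal in
theorem corollary4p2 {A : Type*} [NonUnitalCStarAlgebra A] (I₁ I₂ J₁ J₂ : ClosedIdeal A)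
    (h₁ : I₁ ⊂⊂ J₁) (h₂ : I₂ ⊂⊂ J₂) :
    -- the spatial tensor product, formed in any two faithful representations
    (∀ (H K : Type*) [NormedAddCommGroup H] [InnerProductSpace ℂ H] [CompleteSpace H]
        [NormedAddCommGroup K] [InnerProductSpace ℂ K] [CompleteSpace K]
        (π : A →⋆ₙₐ[ℂ] (H →L[ℂ] H)) (ρ : A →⋆ₙₐ[ℂ] (K →L[ℂ] K))
        (hπ : Function.Injective π) (hρ : Function.Injective ρ),
        ((spatialTensorProduct π ρ hπ hρ).ideal I₁ I₂ ⊂⊂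
          (spatialTensorProduct π ρ hπ hρ).ideal J₁ J₂) ∧
        (I₁.CountablyGenerated → I₂.CountablyGenerated →
          ((spatialTensorProduct π ρ hπ hρ).ideal I₁ I₂).CountablyGenerated) ∧
        (J₁.CountablyGenerated → J₂.CountablyGenerated →
          ((spatialTensorProduct π ρ hπ hρ).ideal J₁ J₂).CountablyGenerated)) ∧
    -- any other C*-tensor product (maximal, intermediate)
    (∀ (T : Type*) [NonUnitalCStarAlgebra T] (τ : CStarTensorProduct A A T),
        (τ.ideal I₁ I₂ ⊂⊂ τ.ideal J₁ J₂) ∧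
        (I₁.CountablyGenerated → I₂.CountablyGenerated →
          (τ.ideal I₁ I₂).CountablyGenerated) ∧
        (J₁.CountablyGenerated → J₂.CountablyGenerated →
          (τ.ideal J₁ J₂).CountablyGenerated)) :=
  ⟨fun _ _ _ _ _ _ _ _ π ρ hπ hρ => corollary4p2_general (spatialTensorProduct π ρ hπ hρ) h₁ h₂,
    fun _ _ τ => corollary4p2_general τ h₁ h₂⟩
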